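/- **Setting.** A *generalized Cartan matrix* (GCM) is a square matrix $M=(M_{ij})_{i,j\in I}$ of integers, indexed by a finite set $I$, with $M_{ii}=2$, with $M_{ij}\le 0$ for $i\neq j$, and with $M_{ij}\ne0\Rightarrow M_{ji}\neq 0$. Its graph has node set $I$, and $i\ne j$ are adjacent when $M_{ij}$ and $M_{ji}$ are nonzero; the graph together with $M$ is a *GCM graph*, and GCM graphs that differ by a bijection of the index sets are identified. A *position* is a vector $\lambda\in\mathbb{R}^I$; it is *dominant* if all $\lambda_i\ge 0$. A node $i$ may be *fired* when $\lambda_i>0$; this replaces each $\lambda_j$ by $\lambda_j-M_{ij}\lambda_i$. A *convergent game sequence* for $\lambda$ is a finite (possibly empty) sequence of nodes that can be legally fired one after another starting at $\lambda$, after which no node has a positive number. A connected GCM graph is *admissible* if some nonzero dominant position has a convergent game sequence. **Proposition 3.1.** Each of the following is a connected GCM graph that is not admissible. (The off-diagonal entries $M_{ij}$ are $0$ for nodes that are not joined by an edge, and both entries of an edge are $-1$ unless stated otherwise.) * $\widetilde{\mathsf A}$: the cycle on $n\ge3$ nodes. * $\widetilde{\mathsf B}$: (i) for $n\geq 4$,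 nodes $1$ and $2$ both joined to $3$, and the path $3-4-\cdots-n$, with $M_{n-1,n}=-2$; (ii) for $n\ge3$, the path $1-2-\cdots-n$ with $M_{21}=-2$ and $M_{n-1,n}=-2$. * $\widetilde{\mathsf C}$: for $n\ge 3$, the path $1-2-\cdots-n$ (i) with $M_{12}=-2$ and $M_{n,n-1}=-2$, or (ii) with $M_{21}=-2$ and $M_{n,n-1}=-2$; (iii) for $n\ge4$, the graph of $\widetilde{\mathsf B}$(i) but with $M_{n-1,n}=-1$ and $M_{n,n-1}=-2$. * $\widetilde{\mathsf D}$: for $n\ge5$, nodes $1,2$ joined to $3$, the path $3-\cdots-(n-2)$, and nodes $n-1,n$ joined to $n-2$. * $\widetilde{\mathsf E}$: the tree with the paths $1-4-5-6-7$ and $2-3-5$; the tree with the paths $1-3-4-5-6-7-8$ and $2-5$; the tree with the paths $1-3-4-5-6-7-8-9$ and $2-4$. * $\widetilde{\mathsf F}$: the path $1-2-3-4-5$ with $M_{23}=-2$, or with $M_{32}=-2$. * $\widetilde{\mathsf G}$: the path $1-2-3$ with $(-M_{12},-M_{21},-M_{23},-M_{32})$ equal to $(1,3,1,1)$, $(1,3,1,2)$,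 $(1,3,1,3)$, $(3,1,1,1)$, $(1,3,2,1)$ or $(1,3,3,1)$. * Triangles on nodes $a,b,c$ with $M_{ab}=-m$, $M_{ba}=-1$, $M_{ac}=-p_1$, $M_{ca}=-q_1$, $M_{bc}=-p_2$, $M_{cb}=-q_2$, where $m\in\{1,2,3\}$ and $p_1,q_1,p_2,q_2$ are positive integers with $p_1q_1\ge m$ and $p_2q_2\ge m$. * The 4-cycles $1-2-3-4-1$ with $M_{12}=-2$ and with $(M_{34},M_{43})$ equal to $(-1,-1)$, $(-1,-2)$ or $(-2,-1)$. * The 5-cycle $1-2-3-4-5-1$ with $M_{12}=-2$. Thus no nonzero dominant initial position on any of these graphs has a convergent game sequence. -/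

import Mathlib

namespace NumbersGame

/-- A generalized Cartan matrix. -/
structure IsGCM {ι : Type*} (M : Matrix ι ι ℤ) : Prop where
  diag : ∀ i, M i i = 2
  nonpos : ∀ i j, i ≠ j → M i j ≤ 0
  ne_zero_symm : ∀ i j, M i j ≠ 0 → M j i ≠ 0

/-- The graph `Γ` associated with a generalized Cartan matrix. -/
def graph {ι : Type*} (M : Matrix ι ι ℤ) : SimpleGraph ι where
  Adj i j := i ≠ j ∧ M i j ≠ 0 ∧ M j i ≠ 0
  symm := ⟨fun _ _ h => ⟨h.1.symm, h.2.2, h.2.1⟩⟩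
  loopless := ⟨fun _ h => h.1 rfl⟩

/-- The position obtained from the position `x` by firing node `i`. -/
def fire {ι : Type*} (M : Matrix ι ι ℤ) (x : ι → ℝ) (i : ι) : ι → ℝ :=
  fun j => x j - (M i j : ℝ) * x i

/-- The position obtained from `x` by firing the nodes of a list one after another. -/
def play {ι : Type*} (M : Matrix ι ι ℤ) : (ι → ℝ) → List ι → (ι → ℝ)
  | x, [] => x
  | x, i :: s => play M (fire M x i) s

/-- Each node of the list has a positive number at the moment when it is fired. -/
def LegalFiringSequence {ι : Type*} (M : Matrix ι ι ℤ) : (ι → ℝ) → List ι → Prop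
  | _, [] => True
  | x, i :: s => 0 < x i ∧ LegalFiringSequence M (fire M x i) s

/-- A convergent game sequence for `x`: a finite legal firing sequence after which no node
has a positive number. -/
def ConvergentGameSequence {ι : Type*} (M : Matrix ι ι ℤ) (x : ι → ℝ) (s : List ι) : Prop :=
  LegalFiringSequence M x s ∧ ∀ i, play M x s i ≤ 0

/-- Some nonzero dominant initial position has a convergent game sequence. -/
def Admissible {ι : Type*} (M : Matrix ι ι ℤ) : Prop :=
  ∃ x : ι → ℝ, (∀ i, 0 ≤ x i) ∧ x ≠ 0 ∧ ∃ s : List ι, ConvergentGameSequence M x s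

/-- The matrix with diagonal entries `2` and with entry `- a i j` in row `i` and column `j ≠ i`,
where the nodes are numbered `1, …, n`. -/
def ofAmplitudes (n : ℕ) (a : ℕ → ℕ → ℕ) : Matrix (Fin n) (Fin n) ℤ :=
  Matrix.of fun i j => if i = j then 2 else -(a (i + 1) (j + 1) : ℤ)

/-- Adjacency in the path `1 - 2 - 3 - ⋯`. -/
abbrev PathAdj (i j : ℕ) : Prop := i + 1 = j ∨ j + 1 = i

/-- Adjacency in the graph in which `1` and `2` are both joined to `3`, followed by the path
`3 - 4 - 5 - ⋯`. -/
abbrev ForkAdj (i j : ℕ) : Prop :=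
  (i = 1 ∧ j = 3) ∨ (j = 1 ∧ i = 3) ∨ (2 ≤ i ∧ i + 1 = j) ∨ (2 ≤ j ∧ j + 1 = i)

/-- The `n`-cycle `1 - 2 - ⋯ - n - 1`. -/
def tildeA (n : ℕ) : Matrix (Fin n) (Fin n) ℤ :=
  ofAmplitudes n fun i j =>
    if PathAdj i j ∨ (i = 1 ∧ j = n) ∨ (i = n ∧ j = 1) then 1 else 0

/-- A fork at `1, 2, 3`, and amplitudes `M (n-1) n = -2`, `M n (n-1) = -1` on the last edge. -/
def tildeB (n : ℕ) : Matrix (Fin n) (Fin n) ℤ :=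
  ofAmplitudes n fun i j =>
    if i + 1 = n ∧ j = n then 2 else if ForkAdj i j then 1 else 0

/-- A path with `M 1 2 = -1`, `M 2 1 = -2`, `M (n-1) n = -2`, `M n (n-1) = -1`. -/
def tildeB' (n : ℕ) : Matrix (Fin n) (Fin n) ℤ :=
  ofAmplitudes n fun i j =>
    if (i = 2 ∧ j = 1) ∨ (i + 1 = n ∧ j = n) then 2 else if PathAdj i j then 1 else 0

/-- A path with `M 1 2 = -2`, `M 2 1 = -1`, `M (n-1) n = -1`, `M n (n-1) = -2`. -/
def tildeC (n : ℕ) : Matrix (Fin n) (Fin n) ℤ :=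
  ofAmplitudes n fun i j =>
    if (i = 1 ∧ j = 2) ∨ (i = n ∧ j + 1 = n) then 2 else if PathAdj i j then 1 else 0

/-- A path with `M 1 2 = -1`, `M 2 1 = -2`, `M (n-1) n = -1`, `M n (n-1) = -2`. -/
def tildeC' (n : ℕ) : Matrix (Fin n) (Fin n) ℤ :=
  ofAmplitudes n fun i j =>
    if (i = 2 ∧ j = 1) ∨ (i = n ∧ j + 1 = n) then 2 else if PathAdj i j then 1 else 0

/-- A fork at `1, 2, 3`, and amplitudes `M (n-1) n = -1`, `M n (n-1) = -2` on the last edge. -/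
def tildeC'' (n : ℕ) : Matrix (Fin n) (Fin n) ℤ :=
  ofAmplitudes n fun i j =>
    if i = n ∧ j + 1 = n then 2 else if ForkAdj i j then 1 else 0

/-- Nodes `1` and `2` are joined to `3`, nodes `n - 1` and `n` are joined to `n - 2`, and
`3 - 4 - ⋯ - (n - 2)` is a path. -/
def tildeD (n : ℕ) : Matrix (Fin n) (Fin n) ℤ :=
  ofAmplitudes n fun i j =>
    if (ForkAdj i j ∧ i < n ∧ j < n) ∨ (i + 2 = n ∧ j = n) ∨ (i = n ∧ j + 2 = n) then 1 else 0

/-- The edges are `1 - 4 - 5 - 6 - 7` and `2 - 3 - 5`. -/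
def tildeE6 : Matrix (Fin 7) (Fin 7) ℤ :=
  !![ 2,  0,  0, -1,  0,  0,  0;
      0,  2, -1,  0,  0,  0,  0;
      0, -1,  2,  0, -1,  0,  0;
     -1,  0,  0,  2, -1,  0,  0;
      0,  0, -1, -1,  2, -1,  0;
      0,  0,  0,  0, -1,  2, -1;
      0,  0,  0,  0,  0, -1,  2]

/-- The edges are `1 - 3 - 4 - 5 - 6 - 7 - 8` and `2 - 5`. -/
def tildeE7 : Matrix (Fin 8) (Fin 8) ℤ :=
  !![ 2,  0, -1,  0,  0,  0,  0,  0;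
      0,  2,  0,  0, -1,  0,  0,  0;
     -1,  0,  2, -1,  0,  0,  0,  0;
      0,  0, -1,  2, -1,  0,  0,  0;
      0, -1,  0, -1,  2, -1,  0,  0;
      0,  0,  0,  0, -1,  2, -1,  0;
      0,  0,  0,  0,  0, -1,  2, -1;
      0,  0,  0,  0,  0,  0, -1,  2]

/-- The edges are `1 - 3 - 4 - 5 - 6 - 7 - 8 - 9` and `2 - 4`. -/
def tildeE8 : Matrix (Fin 9) (Fin 9) ℤ :=
  !![ 2,  0, -1,  0,  0,  0,  0,  0,  0;
      0,  2,  0, -1,  0,  0,  0,  0,  0;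
     -1,  0,  2, -1,  0,  0,  0,  0,  0;
      0, -1, -1,  2, -1,  0,  0,  0,  0;
      0,  0,  0, -1,  2, -1,  0,  0,  0;
      0,  0,  0,  0, -1,  2, -1,  0,  0;
      0,  0,  0,  0,  0, -1,  2, -1,  0;
      0,  0,  0,  0,  0,  0, -1,  2, -1;
      0,  0,  0,  0,  0,  0,  0, -1,  2]

/-- The five-node path in which the edge between nodes `2` and `3` has amplitudes
`M 2 3 = -p`, `M 3 2 = -q` and all other amplitudes are `-1`. -/
def fivePath (p q : ℤ) : Matrix (Fin 5) (Fin 5) ℤ :=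
  !![ 2, -1,  0,  0,  0;
     -1,  2, -p,  0,  0;
      0, -q,  2, -1,  0;
      0,  0, -1,  2, -1;
      0,  0,  0, -1,  2]

/-- The three-node path with `M 1 2 = -p`, `M 2 1 = -q`, `M 2 3 = -r`, `M 3 2 = -s`. -/
def threePath (p q r s : ℤ) : Matrix (Fin 3) (Fin 3) ℤ :=
  !![ 2, -p,  0;
     -q,  2, -r;
      0, -s,  2]

/-- The triangle with nodes `a, b, c` (in this order) and amplitudes
`M a b = -m`, `M b a = -1`, `M a c = -p₁`, `M c a = -q₁`, `M b c = -p₂`, `M c b = -q₂`. -/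
def triangle (m p₁ q₁ p₂ q₂ : ℤ) : Matrix (Fin 3) (Fin 3) ℤ :=
  !![  2,  -m, -p₁;
      -1,   2, -p₂;
     -q₁, -q₂,   2]

/-- The four-cycle `1 - 2 - 3 - 4 - 1` with `M 1 2 = -2`, `M 2 1 = -1`, `M 3 4 = -p`,
`M 4 3 = -q` and all other amplitudes equal to `-1`. -/
def fourCycle (p q : ℤ) : Matrix (Fin 4) (Fin 4) ℤ :=
  !![ 2, -2,  0, -1;
     -1,  2, -1,  0;
      0, -1,  2, -p;
     -1,  0, -q,  2]

/-- The five-cycle `1 - 2 - 3 - 4 - 5 - 1` with `M 1 2 = -2` and all other amplitudes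
equal to `-1`. -/
def fiveCycle : Matrix (Fin 5) (Fin 5) ℤ :=
  !![ 2, -2,  0,  0, -1;
     -1,  2, -1,  0,  0;
      0, -1,  2, -1,  0;
      0,  0, -1,  2, -1;
     -1,  0,  0, -1,  2]

/-- The list of matrices, one numbering of the nodes being chosen for each graph. -/
inductive Listed : (n : ℕ) → Matrix (Fin n) (Fin n) ℤ → Prop
  | A (n : ℕ) : 3 ≤ n → Listed n (tildeA n)
  | B (n : ℕ) : 4 ≤ n → Listed n (tildeB n)
  | B' (n : ℕ) : 3 ≤ n → Listed n (tildeB' n)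
  | C (n : ℕ) : 3 ≤ n → Listed n (tildeC n)
  | C' (n : ℕ) : 3 ≤ n → Listed n (tildeC' n)
  | C'' (n : ℕ) : 4 ≤ n → Listed n (tildeC'' n)
  | D (n : ℕ) : 5 ≤ n → Listed n (tildeD n)
  | E6 : Listed 7 tildeE6
  | E7 : Listed 8 tildeE7
  | E8 : Listed 9 tildeE8
  | F : Listed 5 (fivePath 2 1)
  | F' : Listed 5 (fivePath 1 2)
  | G₁ : Listed 3 (threePath 1 3 1 1)
  | G₂ : Listed 3 (threePath 1 3 1 2)
  | G₃ : Listed 3 (threePath 1 3 1 3)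
  | G₄ : Listed 3 (threePath 3 1 1 1)
  | G₅ : Listed 3 (threePath 1 3 2 1)
  | G₆ : Listed 3 (threePath 1 3 3 1)
  | triangle₁ (p₁ q₁ p₂ q₂ : ℤ) : 1 ≤ p₁ → 1 ≤ q₁ → 1 ≤ p₂ → 1 ≤ q₂ →
      Listed 3 (triangle 1 p₁ q₁ p₂ q₂)
  | triangle₂ (p₁ q₁ p₂ q₂ : ℤ) : 1 ≤ p₁ → 1 ≤ q₁ → 1 ≤ p₂ → 1 ≤ q₂ →
      2 ≤ p₁ * q₁ → 2 ≤ p₂ * q₂ → Listed 3 (triangle 2 p₁ q₁ p₂ q₂)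
  | triangle₃ (p₁ q₁ p₂ q₂ : ℤ) : 1 ≤ p₁ → 1 ≤ q₁ → 1 ≤ p₂ → 1 ≤ q₂ →
      3 ≤ p₁ * q₁ → 3 ≤ p₂ * q₂ → Listed 3 (triangle 3 p₁ q₁ p₂ q₂)
  | square₁ : Listed 4 (fourCycle 1 1)
  | square₂ : Listed 4 (fourCycle 1 2)
  | square₃ : Listed 4 (fourCycle 2 1)
  | pentagon : Listed 5 fiveCycle

/-- `M` is, up to a bijection between the index sets, one of the listed matrices. -/
def IsListed {ι : Type*} (M : Matrix ι ι ℤ) : Prop :=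
  ∃ (n : ℕ) (A : Matrix (Fin n) (Fin n) ℤ), Listed n A ∧
    ∃ e : ι ≃ Fin n, ∀ i j, M i j = A (e i) (e j)

end NumbersGame

open Finset

namespace NumbersGame

/-! Everything rests on a vector `v > 0` with `M v ≤ 0`. Firing `i` changes the pairing `∑ j, x j *
v j` by `-x i * (M v) i`, which is nonnegative because a legal firing has `x i > 0`. A nonzero
dominant position pairs positively with `v`, whereas a position without positive entries pairs
nonpositively, so no legal sequence leads from one to the other. What remains is to exhibit `v` for
each listed matrix. For the affine ones it is a null vector of `M`; elsewhere, as only `≤` is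
needed, a simple vector such as all ones suffices. Connectivity follows by descending from each node
to a root through neighbours of smaller rank. -/

/-- A connected generalized Cartan matrix, together with a positive integral vector that it maps
to a vector with no positive entry. -/
def IsNonFinite {ι : Type*} [Fintype ι] (M : Matrix ι ι ℤ) : Prop :=
  IsGCM M ∧ (graph M).Connected ∧ ∃ v : ι → ℤ, (∀ i, 0 < v i) ∧ ∀ i, ∑ j, M i j * v j ≤ 0

/-! ### The monotone pairing, connectivity by rank, and relabelling -/

section General

variable {ι : Type*}

/-- Pairing with a vector `v` such that `M v ≤ 0` is monotone along legal firing sequences. -/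
theorem sum_le_sum_play [Fintype ι] {M : Matrix ι ι ℤ} {v : ι → ℤ}
    (hv : ∀ i, ∑ j, M i j * v j ≤ 0) (s : List ι) (x : ι → ℝ) (hs : LegalFiringSequence M x s) :
    ∑ j, x j * v j ≤ ∑ j, play M x s j * v j := by
  induction s generalizing x with
  | nil => exact le_rfl
  | cons i s ih =>
    refine le_trans ?_ (ih (fire M x i) hs.2)
    have h : ∑ j, fire M x i j * (v j : ℝ)
        = ∑ j, x j * v j - x i * ((∑ j, M i j * v j : ℤ) : ℝ) := by
      push_cast
      rw [Finset.mul_sum, ← Finset.sum_sub_distrib]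
      exact Finset.sum_congr rfl fun j _ => by simp only [fire]; ring
    have h' : ((∑ j, M i j * v j : ℤ) : ℝ) ≤ 0 := by exact_mod_cast hv i
    rw [h]
    nlinarith [mul_nonneg hs.1.le (neg_nonneg.2 h')]

theorem not_admissible_of_mulVec_nonpos [Fintype ι] {M : Matrix ι ι ℤ} {v : ι → ℤ}
    (hpos : ∀ i, 0 < v i) (hv : ∀ i, ∑ j, M i j * v j ≤ 0) : ¬ Admissible M := by
  rintro ⟨x, hx, hx0, s, hs, hend⟩
  have hpos' : ∀ i, (0 : ℝ) < v i := fun i => by exact_mod_cast hpos i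
  obtain ⟨i, hi⟩ := Function.ne_iff.1 hx0
  have hstart : 0 < ∑ j, x j * v j :=
    -- One positive coordinate is enough, since every weight is strictly positive.
    Finset.sum_pos' (fun j _ => mul_nonneg (hx j) (hpos' j).le)
      ⟨i, Finset.mem_univ i, mul_pos (lt_of_le_of_ne (hx i) (Ne.symm hi)) (hpos' i)⟩
  have hfinal : ∑ j, play M x s j * v j ≤ 0 :=
    Finset.sum_nonpos fun j _ => mul_nonpos_of_nonpos_of_nonneg (hend j) (hpos' j).le
  exact absurd (sum_le_sum_play hv s x hs) (not_le.2 (hfinal.trans_lt hstart))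

/-- A graph is connected if every node other than the root has a neighbour of smaller rank. -/
theorem graph_connected_of_rank {M : Matrix ι ι ℤ} (hM : IsGCM M) (root : ι) (ρ : ι → ℕ)
    (h : ∀ i, i ≠ root → ∃ j, ρ j < ρ i ∧ M i j ≠ 0) : (graph M).Connected := by
  have key : ∀ k i, ρ i = k → (graph M).Reachable i root := by
    intro k
    induction k using Nat.strong_induction_on with
    | _ k ih =>
      intro i hi
      by_cases hr : i = root
      · exact hr ▸ SimpleGraph.Reachable.refl _
      · obtain ⟨j, hj, hij⟩ := h i hr
        have hadj : (graph M).Adj i j :=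
          ⟨fun e => hj.ne (by rw [e]), hij, hM.ne_zero_symm i j hij⟩
        exact hadj.reachable.trans (ih (ρ j) (hi ▸ hj) j rfl)
  have : Nonempty ι := ⟨root⟩
  exact ⟨fun i j => (key _ i rfl).trans (key _ j rfl).symm⟩

theorem IsNonFinite.of_equiv {κ : Type*} [Fintype ι] [Fintype κ] {M : Matrix ι ι ℤ}
    {A : Matrix κ κ ℤ} (hA : IsNonFinite A) (e : ι ≃ κ) (he : ∀ i j, M i j = A (e i) (e j)) :
    IsNonFinite M := by
  obtain ⟨hG, hC, v, hpos, hv⟩ := hA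
  refine ⟨⟨fun i => ?_, fun i j hij => ?_, fun i j hij => ?_⟩, ?_, fun i => v (e i),
    fun i => hpos _, fun i => ?_⟩
  · rw [he, hG.diag]
  · rw [he]
    exact hG.nonpos _ _ (e.injective.ne hij)
  · rw [he] at hij ⊢
    exact hG.ne_zero_symm _ _ hij
  · let f : graph M ≃g graph A :=
      { toEquiv := e
        map_rel_iff' := by intro i j; simp [graph, he] }
    exact f.connected_iff.2 hC
  · simp only [he]
    rw [Equiv.sum_comp e fun j => A (e i) j * v j]
    exact hv _

theorem isNonFinite_of_rank [Fintype ι] {M : Matrix ι ι ℤ} (hM : IsGCM M) (root : ι) (ρ : ι → ℕ)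
    (h : ∀ i, i ≠ root → ∃ j, ρ j < ρ i ∧ M i j ≠ 0) (v : ι → ℤ) (hpos : ∀ i, 0 < v i)
    (hv : ∀ i, ∑ j, M i j * v j ≤ 0) : IsNonFinite M :=
  ⟨hM, graph_connected_of_rank hM root ρ h, v, hpos, hv⟩

end General

/-! ### Infinite families, with null vectors as weights -/

section Families

/-- A criterion for matrices given by amplitudes. The set `S i` is a set of nodes other than `i`
whose weighted sum already outweighs `2 * w i`. -/
theorem isNonFinite_ofAmplitudes {n : ℕ} {a : ℕ → ℕ → ℕ} (ha : ∀ i j, a i j ≠ 0 → a j i ≠ 0)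
    (w ρ : ℕ → ℕ) (root : ℕ) (hr : 1 ≤ root) (hrn : root ≤ n) (hw : ∀ i, 0 < w i)
    (hρ : ∀ i, 1 ≤ i → i ≤ n → i ≠ root → ∃ j, 1 ≤ j ∧ j ≤ n ∧ ρ j < ρ i ∧ a i j ≠ 0)
    (hS : ∀ i, 1 ≤ i → i ≤ n → ∃ S : Finset ℕ,
      (∀ j ∈ S, 1 ≤ j ∧ j ≤ n ∧ j ≠ i) ∧ 2 * w i ≤ ∑ j ∈ S, a i j * w j) :
    IsNonFinite (ofAmplitudes n a) := by
  have hne : ∀ i j : Fin n, i ≠ j → ofAmplitudes n a i j = -(a (i + 1) (j + 1) : ℤ) :=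
    fun i j h => by simp [ofAmplitudes, h]
  have hGCM : IsGCM (ofAmplitudes n a) := by
    refine ⟨fun i => by simp [ofAmplitudes], fun i j hij => by simp [hne i j hij], ?_⟩
    intro i j hij
    by_cases h : i = j
    · simp [ofAmplitudes, h]
    · rw [hne i j h, neg_ne_zero, Nat.cast_ne_zero] at hij
      rw [hne j i (Ne.symm h), neg_ne_zero, Nat.cast_ne_zero]
      exact ha _ _ hij
  -- `Fin n` starts at 0 while amplitudes, weights and ranks are indexed from 1.
  refine isNonFinite_of_rank hGCM ⟨root - 1, by omega⟩ (fun i => ρ (i + 1)) ?_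
    (fun i => w (i + 1)) (fun i => by exact_mod_cast hw _) ?_
  · intro i hi
    have hi' : (i : ℕ) + 1 ≠ root := fun h => hi (Fin.ext (by simp only; omega))
    obtain ⟨j, hj, hjn, hlt, hij⟩ := hρ (i + 1) (by omega) (by omega) hi'
    obtain ⟨k, rfl⟩ : ∃ k, j = k + 1 := ⟨j - 1, by omega⟩
    refine ⟨⟨k, by omega⟩, hlt, ?_⟩
    rw [hne _ _ (fun h => by rw [h] at hlt; exact lt_irrefl _ hlt), neg_ne_zero, Nat.cast_ne_zero]
    exact hij
  · intro i
    obtain ⟨S, hSn, hle⟩ := hS (i + 1) (by omega) (by omega)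
    have hsub : S ⊆ (univ.erase i).image fun j : Fin n => (j : ℕ) + 1 := by
      intro j hj
      obtain ⟨h1, hn, hji⟩ := hSn j hj
      refine mem_image.2 ⟨⟨j - 1, by omega⟩, mem_erase.2 ⟨fun h => ?_, mem_univ _⟩, ?_⟩
      · rw [← h] at hji
        simp only at hji
        omega
      · simp only
        omega
    -- Amplitudes and weights are natural numbers, so nodes outside `S` can only increase the sum.
    have hle' : 2 * w (i + 1) ≤ ∑ j ∈ univ.erase i, a (i + 1) (j + 1) * w (j + 1) := by
      refine hle.trans ((sum_le_sum_of_subset hsub).trans_eq ?_)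
      rw [sum_image fun x _ y _ h => Fin.ext (by simpa using h)]
    rw [← add_sum_erase univ _ (mem_univ i),
      sum_congr rfl fun j hj => by rw [hne i j (Ne.symm (mem_erase.1 hj).1), neg_mul],
      sum_neg_distrib, hGCM.diag]
    have : (2 * w (i + 1) : ℤ) ≤ ∑ j ∈ univ.erase i, (a (i + 1) (j + 1) * w (j + 1) : ℤ) := by
      exact_mod_cast hle'
    linarith

theorem isNonFinite_tildeA {n : ℕ} (hn : 3 ≤ n) : IsNonFinite (tildeA n) := by
  refine isNonFinite_ofAmplitudes ?_ (fun _ => 1) id 1 le_rfl (by omega) (by simp) ?_ ?_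
  · grind
  · exact fun i h1 hi hr => ⟨i - 1, by grind⟩
  · intro i h1 hi
    -- The two cyclic neighbours, distinct because `n ≥ 3`.
    refine ⟨{if i = 1 then n else i - 1, if i = n then 1 else i + 1}, by grind, ?_⟩
    rw [sum_pair (by grind)]
    grind

theorem isNonFinite_tildeB' {n : ℕ} (hn : 3 ≤ n) : IsNonFinite (tildeB' n) := by
  refine isNonFinite_ofAmplitudes ?_ (fun i => if i = 1 ∨ i = n then 1 else 2) id 1 le_rfl
    (by omega) (by grind) ?_ ?_
  · grind
  · exact fun i h1 hi hr => ⟨i - 1, by grind⟩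
  · intro i h1 hi
    by_cases hi1 : i = 1
    · exact ⟨{2}, by grind, by rw [sum_singleton]; grind⟩
    by_cases hin : i = n
    · exact ⟨{n - 1}, by grind, by rw [sum_singleton]; grind⟩
    exact ⟨{i - 1, i + 1}, by grind, by rw [sum_pair (by grind)]; grind⟩

/-- The amplitudes 2 lie in the rows of the two end nodes and make up for their missing neighbour,
so constant weights work as for a cycle. -/
theorem isNonFinite_tildeC {n : ℕ} (hn : 3 ≤ n) : IsNonFinite (tildeC n) := by
  refine isNonFinite_ofAmplitudes ?_ (fun _ => 1) id 1 le_rfl (by omega) (by simp) ?_ ?_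
  · grind
  · exact fun i h1 hi hr => ⟨i - 1, by grind⟩
  · intro i h1 hi
    by_cases hi1 : i = 1
    · exact ⟨{2}, by grind, by rw [sum_singleton]; grind⟩
    by_cases hin : i = n
    · exact ⟨{n - 1}, by grind, by rw [sum_singleton]; grind⟩
    exact ⟨{i - 1, i + 1}, by grind, by rw [sum_pair (by grind)]; grind⟩

theorem isNonFinite_tildeC' {n : ℕ} (hn : 3 ≤ n) : IsNonFinite (tildeC' n) := by
  refine isNonFinite_ofAmplitudes ?_ (fun i => if i = 1 then 1 else 2) id 1 le_rfl
    (by omega) (by grind) ?_ ?_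
  · grind
  · exact fun i h1 hi hr => ⟨i - 1, by grind⟩
  · intro i h1 hi
    by_cases hi1 : i = 1
    · exact ⟨{2}, by grind, by rw [sum_singleton]; grind⟩
    by_cases hin : i = n
    · exact ⟨{n - 1}, by grind, by rw [sum_singleton]; grind⟩
    exact ⟨{i - 1, i + 1}, by grind, by rw [sum_pair (by grind)]; grind⟩

theorem isNonFinite_tildeB {n : ℕ} (hn : 4 ≤ n) : IsNonFinite (tildeB n) := by
  refine isNonFinite_ofAmplitudes ?_ (fun i => if i ≤ 2 ∨ i = n then 1 else 2)
    -- Rooted at `n`: every other node has a neighbour of larger index, whereas node 2 has none of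
    -- smaller index.
    (fun i => n - i) n (by omega) le_rfl (by grind) ?_ ?_
  · grind
  · exact fun i h1 hi hr => ⟨if i = 1 then 3 else i + 1, by grind⟩
  · intro i h1 hi
    by_cases hi2 : i ≤ 2
    · exact ⟨{3}, by grind, by rw [sum_singleton]; grind⟩
    by_cases hi3 : i = 3
    · exact ⟨{1, 2, 4}, by grind, by rw [sum_insert (by grind), sum_pair (by grind)]; grind⟩
    by_cases hin : i = n
    · exact ⟨{n - 1}, by grind, by rw [sum_singleton]; grind⟩
    exact ⟨{i - 1, i + 1}, by grind, by rw [sum_pair (by grind)]; grind⟩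

theorem isNonFinite_tildeC'' {n : ℕ} (hn : 4 ≤ n) : IsNonFinite (tildeC'' n) := by
  refine isNonFinite_ofAmplitudes ?_ (fun i => if i ≤ 2 then 1 else 2)
    (fun i => n - i) n (by omega) le_rfl (by grind) ?_ ?_
  · grind
  · exact fun i h1 hi hr => ⟨if i = 1 then 3 else i + 1, by grind⟩
  · intro i h1 hi
    by_cases hi2 : i ≤ 2
    · exact ⟨{3}, by grind, by rw [sum_singleton]; grind⟩
    by_cases hi3 : i = 3
    · exact ⟨{1, 2, 4}, by grind, by rw [sum_insert (by grind), sum_pair (by grind)]; grind⟩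
    by_cases hin : i = n
    · exact ⟨{n - 1}, by grind, by rw [sum_singleton]; grind⟩
    exact ⟨{i - 1, i + 1}, by grind, by rw [sum_pair (by grind)]; grind⟩

theorem isNonFinite_tildeD {n : ℕ} (hn : 5 ≤ n) : IsNonFinite (tildeD n) := by
  refine isNonFinite_ofAmplitudes ?_ (fun i => if i ≤ 2 ∨ n ≤ i + 1 then 1 else 2)
    (fun i => if i ≤ 2 then 1 else i - 3) 3 (by omega) (by omega) (by grind) ?_ ?_
  · grind
  · exact fun i h1 hi hr => ⟨if i ≤ 2 then 3 else if i = n then n - 2 else i - 1, by grind⟩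
  · intro i h1 hi
    by_cases hi2 : i ≤ 2
    · exact ⟨{3}, by grind, by rw [sum_singleton]; grind⟩
    by_cases hin : n ≤ i + 1
    · exact ⟨{n - 2}, by grind, by rw [sum_singleton]; grind⟩
    by_cases hi3 : i = 3
    -- For `n = 5` both forks meet at node 3, which then has four leaves of weight 1.
    · by_cases hn5 : n = 5
      · exact ⟨{1, 2, 4, 5}, by grind, by
          rw [sum_insert (by grind), sum_insert (by grind), sum_pair (by grind)]; grind⟩
      · exact ⟨{1, 2, 4}, by grind, by rw [sum_insert (by grind), sum_pair (by grind)]; grind⟩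
    by_cases hin2 : i + 2 = n
    · exact ⟨{i - 1, i + 1, n}, by grind, by
        rw [sum_insert (by grind), sum_pair (by grind)]; grind⟩
    exact ⟨{i - 1, i + 1}, by grind, by rw [sum_pair (by grind)]; grind⟩

end Families

/-! ### Explicit small matrices and triangles -/

section Sporadic

/-- For an explicit integer matrix the three conditions are decidable, where `next i` is a
neighbour of `i` that is closer to the last node. -/
theorem isNonFinite_of_decide {n : ℕ} {M : Matrix (Fin (n + 1)) (Fin (n + 1)) ℤ}
    (v : Fin (n + 1) → ℤ) (next : Fin (n + 1) → Fin (n + 1))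
    (hM : (∀ i, M i i = 2) ∧ (∀ p : _ × _, p.1 ≠ p.2 → M p.1 p.2 ≤ 0) ∧
      ∀ p : _ × _, M p.1 p.2 ≠ 0 → M p.2 p.1 ≠ 0)
    (h : ∀ i, i ≠ Fin.last n → i < next i ∧ M i (next i) ≠ 0)
    (hv : ∀ i, 0 < v i ∧ ∑ j, M i j * v j ≤ 0) : IsNonFinite M := by
  refine isNonFinite_of_rank ⟨hM.1, fun i j => hM.2.1 (i, j), fun i j => hM.2.2 (i, j)⟩
    (Fin.last n) (fun i => n - i) (fun i hi => ⟨next i, ?_, (h i hi).2⟩) v (fun i => (hv i).1)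
    fun i => (hv i).2
  have := (h i hi).1
  omega

/-- The weights are the marks of the affine diagram and satisfy `M v = 0`. The entries of `next`
count from 0; the last one is a filler. -/
theorem isNonFinite_tildeE6 : IsNonFinite tildeE6 :=
  isNonFinite_of_decide ![1, 1, 2, 2, 3, 2, 1] ![3, 2, 4, 4, 5, 6, 6]
    (by decide) (by decide) (by decide)

theorem isNonFinite_tildeE7 : IsNonFinite tildeE7 :=
  isNonFinite_of_decide ![1, 2, 2, 3, 4, 3, 2, 1] ![2, 4, 3, 4, 5, 6, 7, 7]
    (by decide) (by decide) (by decide)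

set_option maxHeartbeats 1000000 in
theorem isNonFinite_tildeE8 : IsNonFinite tildeE8 :=
  isNonFinite_of_decide ![2, 3, 4, 6, 5, 4, 3, 2, 1] ![2, 3, 3, 4, 5, 6, 7, 8, 8]
    (by decide) (by decide) (by decide)

/-- Each row has two off-diagonal entries at most `-1` against the diagonal 2, so the all-ones
vector works. -/
theorem isNonFinite_triangle {m p₁ q₁ p₂ q₂ : ℤ} (hm : 1 ≤ m) (hp₁ : 1 ≤ p₁) (hq₁ : 1 ≤ q₁)
    (hp₂ : 1 ≤ p₂) (hq₂ : 1 ≤ q₂) : IsNonFinite (triangle m p₁ q₁ p₂ q₂) := by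
  refine isNonFinite_of_decide (fun _ => 1) (fun _ => Fin.last 2) ⟨?_, ?_, ?_⟩ ?_ ?_
  · simp [triangle, Fin.forall_fin_succ]
  · simp [triangle, Fin.forall_fin_succ]
    omega
  · simp [triangle, Fin.forall_fin_succ]
    omega
  · intro i hi
    refine ⟨lt_of_le_of_ne (Fin.le_last i) hi, ?_⟩
    fin_cases i <;> simp [triangle] at hi ⊢ <;> omega
  · intro i
    fin_cases i <;> simp [triangle, Fin.sum_univ_succ] <;> omega

theorem Listed.isNonFinite {n : ℕ} {A : Matrix (Fin n) (Fin n) ℤ} (hA : Listed n A) :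
    IsNonFinite A := by
  cases hA with
  | A _ h => exact isNonFinite_tildeA h
  | B _ h => exact isNonFinite_tildeB h
  | B' _ h => exact isNonFinite_tildeB' h
  | C _ h => exact isNonFinite_tildeC h
  | C' _ h => exact isNonFinite_tildeC' h
  | C'' _ h => exact isNonFinite_tildeC'' h
  | D _ h => exact isNonFinite_tildeD h
  | E6 => exact isNonFinite_tildeE6
  | E7 => exact isNonFinite_tildeE7
  | E8 => exact isNonFinite_tildeE8
  | F =>
    exact isNonFinite_of_decide ![2, 4, 3, 2, 1] ![1, 2, 3, 4, 4] (by decide) (by decide) (by decide)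
  | F' =>
    exact isNonFinite_of_decide ![1, 2, 3, 2, 1] ![1, 2, 3, 4, 4] (by decide) (by decide) (by decide)
  | G₄ =>
    exact isNonFinite_of_decide ![3, 2, 1] ![1, 2, 2] (by decide) (by decide) (by decide)
  -- With `(p, q) = (1, 3)` the rows give `0`, `1 - r` and `2 - 2 * s`, so one vector serves all `r,
  -- s ≥ 1`.
  | G₁ | G₂ | G₃ | G₅ | G₆ =>
    exact isNonFinite_of_decide ![1, 2, 1] ![1, 2, 2] (by decide) (by decide) (by decide)
  | triangle₁ _ _ _ _ h₁ h₂ h₃ h₄ => exact isNonFinite_triangle (by norm_num) h₁ h₂ h₃ h₄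
  | triangle₂ _ _ _ _ h₁ h₂ h₃ h₄ => exact isNonFinite_triangle (by norm_num) h₁ h₂ h₃ h₄
  | triangle₃ _ _ _ _ h₁ h₂ h₃ h₄ => exact isNonFinite_triangle (by norm_num) h₁ h₂ h₃ h₄
  -- On a cycle every node has two neighbours, so all row sums are at most 0.
  | square₁ | square₂ | square₃ =>
    exact isNonFinite_of_decide (fun _ => 1) ![1, 2, 3, 3] (by decide) (by decide) (by decide)
  | pentagon =>
    exact isNonFinite_of_decide (fun _ => 1) ![1, 2, 3, 4, 4] (by decide) (by decide) (by decide)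

end Sporadic

end NumbersGame

theorem proposition3p1 {ι : Type*} (M : Matrix ι ι ℤ) (hM : NumbersGame.IsListed M) :
    NumbersGame.IsGCM M ∧ (NumbersGame.graph M).Connected ∧ ¬ NumbersGame.Admissible M := by
  obtain ⟨n, A, hA, e, he⟩ := hM
  have : Fintype ι := Fintype.ofEquiv _ e.symm
  obtain ⟨hG, hC, v, hpos, hv⟩ := hA.isNonFinite.of_equiv e he
  exact ⟨hG, hC, NumbersGame.not_admissible_of_mulVec_nonpos hpos hv⟩
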